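/- Let $c$ be an integer with $1 \le c \le 10^{1000}$ and let $f(x) = x^2 + \frac{1}{c} \in \mathbb{Q}[x]$. For $n \ge 0$ let $f^n$ denote the $n$-th iterate of $f$ under composition, with $f^0(x) = x$. If the second iterate $f^2 = f \circ f$ is irreducible over $\mathbb{Q}$, then $f^n$ is irreducible over $\mathbb{Q}$ for all $n \ge 0$. -/

import Mathlib

open Polynomial

/-!
Write `f = x ^ 2 + 1 / c`. If `f^[n]` is irreducible of even degree and `f^[n + 1]` is not, then
`f^[n + 1]` is `p (x) * p (-x)` for some `p`, so that `f^[n + 1] (0)` is a square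
(`irreducible_comp_sq_add`). The value `f^[k + 1] (0)` is `a k / c ^ 2 ^ k` with `a 0 = 1` and
`a (k + 1) = a k ^ 2 + c ^ (2 ^ (k + 1) - 1)` (`orbitNum`), and it remains to see that `a k` is
not a square for `k ≥ 2` (`not_isSquare_orbitNum`). For `c < 5` congruences suffice. Let `c ≥ 5`,
and put `N = 2 ^ k - 1` and `a = a (k - 1)`.

If `a ^ 2 + c ^ N = b ^ 2`, the factors `b - a` and `b + a` of `c ^ N` have no common factor
except possibly `2`. For odd `c` they are `N`-th powers `d ^ N` and `e ^ N` with `d * e = c`, and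
for even `c` one finds `e ^ N / 4 - d ^ N = ± a` with `d * e = c`. Now `a` is close to
`c ^ (N / 2) / √c`, since the critical orbit stays close to `1 / c` (`orbitNum_bounds`), and this
is small compared with `c ^ (N / 2)`. For odd `c` it follows that `e - d < 2`, which is absurd.
For even `c`, writing `e = r * exp y`, `d = r * exp (-y)` turns the equation into
`sinh (N * y - log 2) ≈ ± 1 / r`. Solving for `y` shows that `w = e + d` and `m = e - d` satisfy

  `w - m * coth (log 2 / N) ± 2 / (N * sinh (log 2 / N)) = O (1 / c)`,

an inhomogeneous linear form with explicit error (`linear_form`), where `N * m` is at most about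
`2 * √c`.

For `c < 10 ^ 4` only finitely many exponents remain, which are enumerated (`no_small_solution`).
For larger `c` the form is multiplied by an integer `Q` for which `Q * coth (log 2 / N)` is close
to an integer while `Q * 2 / (N * sinh (log 2 / N))` is not. This is impossible for all `m` in a
long range, whose length is typically of the order of the square of its left end point, so few
values of `Q`, which are denominators of convergents of `coth (log 2 / N)`, exclude all `m` up to
the bound given by `c ≤ 10 ^ 1000`. That bound also leaves only the exponents with `k < 1668`. The
search for suitable `Q` (`search`) is evaluated by the kernel for each of them, with `log 2` and
`exp (log 2 / N)` enclosed in fixed-point arithmetic; its soundness (`not_of_search`,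
`not_of_check`) does not depend on how `Q` was found.
-/

/-! ### A certified search -/

/-- Application of a function to a natural number whose value is computed first: `force n f` is
`f n`, but kernel evaluation has to reduce `n` to a literal before it unfolds `f`. -/
def force {α : Type} (n : ℕ) (f : ℕ → α) : α :=
  Nat.rec (f 0) (fun k _ => f (Nat.succ k)) n

@[simp] theorem force_eq {α : Type} (n : ℕ) (f : ℕ → α) : force n f = f n := by
  cases n <;> rfl

/-- The fixed-point value, in units of `1 / S`, of the partial sum `∑ 1 / (i * 2 ^ i)`, `1 ≤ i ≤ k`,
of the series for `log 2`, each term rounded down, added to the accumulator. -/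
def logTwoSum (S : ℕ) : ℕ → ℕ → ℕ
  | 0, s => s
  | k + 1, s => force (s + S / (2 ^ (k + 1) * (k + 1))) fun s' => logTwoSum S k s'

/-- Horner's scheme for the exponential series at `x / S` in units of `1 / S`, rounded down. -/
def hornerLo (S x : ℕ) : ℕ → ℕ → ℕ
  | 0, y => y
  | k + 1, y => force (S + x * y / (S * (k + 1))) fun y' => hornerLo S x k y'

/-- Horner's scheme for the exponential series at `x / S` in units of `1 / S`, rounded up. -/
def hornerHi (S x : ℕ) : ℕ → ℕ → ℕ
  | 0, y => y
  | k + 1, y => force (S + x * y / (S * (k + 1)) + 1) fun y' => hornerHi S x k y'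

/-- One step of the search: multiplying `w - m * C + ε * B` by `Q` shows that this linear form
cannot be as small as `24 / max 40000 ((N * m) ^ 2)` for the given `m` and up to the value
returned (exclusively). The real numbers `C` and `B` are known through `Clo ≤ D * C ≤ Chi` and
`Blo ≤ D * B ≤ Blo + Bd`. -/
def searchStep (N D Clo Chi Blo Bd Q m : ℕ) : ℕ :=
  force (Q * Clo) fun u => force ((u + D / 2) / D) fun P =>
  force (Q * Chi - P * D + (P * D - u)) fun η => force (Q * Blo % D) fun r =>
  force (min r (D - (r + Q * Bd))) fun s =>
  force (24 * D * Q / max 40000 (N * N * (m * m)) + 1) fun e =>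
  bif Nat.blt e s then max m ((s - e - 1) / η + 1) else m

/-- The Euclidean algorithm on `(a, b)` with the recursion for the denominators `Q` of the
convergents, run until `Q` exceeds `t` or the fuel is used up; the state reached is handed to `f`.
The plain functions on `ℕ` and the recursor are what the kernel evaluates fastest. -/
def euclid (t : ℕ) (f : ℕ → ℕ → ℕ → ℕ → Bool) (k : ℕ) : ℕ → ℕ → ℕ → ℕ → Bool :=
  Nat.rec f (fun _ ih a b Q₀ Q =>
    bif Nat.ble Q t then
      force (Nat.mod a b) fun b' => force (Nat.add Q₀ (Nat.mul (Nat.div a b) Q)) fun Q' =>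
      ih b b' Q Q'
    else f a b Q₀ Q) k

/-- Search along the denominators `Q` of the convergents of `C`: all values below `m` have been
excluded already, and `searchStep` raises `m` until `N * m` exceeds the bound `L`. Denominators up
to `t` are passed over, as a larger `Q` covers a longer range of `m`; the choice of `t`, a fixed
fraction of `(N * m) ^ 2` that is never above `q`, only serves to find a suitable `Q` sooner. -/
def search (L N D Clo Chi Blo Bd q : ℕ) : ℕ → ℕ → ℕ → ℕ → ℕ → ℕ → ℕ → Bool
  | 0, _, _, _, _, _, _ => false
  | k + 1, m, t, a, b, Q₀, Q =>
    euclid t (fun a b Q₀ Q =>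
      force (searchStep N D Clo Chi Blo Bd Q m) fun m' =>
      bif Nat.blt L (N * m') then true else
      force (min (N * N * (m' * m') / 2 ^ 32) q) fun t' =>
      force (a % b) fun b' => force (Q₀ + a / b * Q) fun Q' =>
      search L N D Clo Chi Blo Bd q k m' t' b b' Q Q') 3000 a b Q₀ Q

/-- The search for the exponent `N = 2 ^ k - 1`. From `l ≤ S * log 2 ≤ l + 4000` it encloses
`exp (log 2 / N)` between `y / S` and `z / S`, and from this the coefficients of the linear form,
with denominator `D`. -/
def check (S l k : ℕ) : Bool :=
  force (204 * 10 ^ 498) fun L =>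
  force (2 ^ k - 1) fun N =>
  force (3500 / (k - 1) + 20) fun T =>
  force (hornerLo S (l / N) T S) fun y =>
  force (hornerHi S ((l + 4000) / N + 1) T (2 * S)) fun z =>
  force (2 ^ (2 * (1661 - k) + 64)) fun D =>
  force ((z * z + S * S) * D / (z * z - S * S)) fun Clo =>
  force ((y * y + S * S) * D / (y * y - S * S) + 1) fun Chi =>
  force (4 * z * S * D / (N * (z * z - S * S))) fun Blo =>
  force (4 * y * S * D / (N * (y * y - S * S)) + 1 - Blo) fun Bd =>
  force (L / N * 256) fun q =>
  force (min (N * N / 2 ^ 32) q) fun t =>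
  force (Clo % D) fun b =>
  Nat.blt S y && search L N D Clo Chi Blo Bd q 3000 1 t D b 0 1

/-- `check` for the exponents `k, k + 1, …, k + i - 1`. -/
def checkFrom (S l : ℕ) : ℕ → ℕ → Bool
  | 0, _ => true
  | i + 1, k => check S l k && force (k + 1) fun k' => checkFrom S l i k'

/-- `checkFrom` with 3500 binary digits of `log 2`. -/
def checkRange (i k : ℕ) : Bool :=
  force (2 ^ 3500) fun S => force (logTwoSum S 3500 0 - 1) fun l => checkFrom S l i k

/-! ### Soundness of the search -/

theorem natCast_div_le_real (a b : ℕ) : ((a / b : ℕ) : ℝ) ≤ (a : ℝ) / b :=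
  Nat.cast_div_le

theorem real_div_le_natCast_div_add_one (a b : ℕ) : (a : ℝ) / b ≤ ((a / b : ℕ) : ℝ) + 1 := by
  have := (Nat.lt_floor_add_one ((a : ℝ) / b)).le
  rwa [Nat.floor_div_eq_div] at this

theorem hornerLo_div_le {S : ℕ} (hS : 0 < S) {x : ℕ} {X : ℝ} (hx : (x : ℝ) / S ≤ X) (k y : ℕ) :
    (hornerLo S x k y : ℝ) / S ≤
      ∑ j ∈ Finset.range k, X ^ j / j.factorial + X ^ k / k.factorial * (y / S) := by
  have hS' : (0 : ℝ) < S := by exact_mod_cast hS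
  have hX : 0 ≤ X := le_trans (by positivity) hx
  induction k generalizing y with
  | zero => simp [hornerLo]
  | succ k ih =>
    rw [hornerLo, force_eq, Finset.sum_range_succ, add_assoc]
    refine (ih _).trans (add_le_add le_rfl ?_)
    have h1 : ((S + x * y / (S * (k + 1)) : ℕ) : ℝ) / S ≤ 1 + X * (y / S) / (k + 1) := by
      have h2 : ((x * y / (S * (k + 1)) : ℕ) : ℝ) ≤ (x * y : ℝ) / (S * (k + 1)) := by
        exact_mod_cast natCast_div_le_real (x * y) (S * (k + 1))
      have h3 : (x * y : ℝ) / (S * (k + 1)) = x / S * (y / S) / (k + 1) * S := by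
        field_simp
      have h4 : (x : ℝ) / S * (y / S) / (k + 1) ≤ X * (y / S) / (k + 1) := by gcongr
      rw [div_le_iff₀ hS']
      push_cast at h2 ⊢
      nlinarith
    calc X ^ k / k.factorial * (((S + x * y / (S * (k + 1)) : ℕ) : ℝ) / S)
        ≤ X ^ k / k.factorial * (1 + X * (y / S) / (k + 1)) := by gcongr
      _ = _ := by
        rw [Nat.factorial_succ]; push_cast; field_simp; ring

theorem le_hornerHi_div {S : ℕ} (hS : 0 < S) {x : ℕ} {X : ℝ} (hX : 0 ≤ X) (hx : X ≤ (x : ℝ) / S)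
    (k y : ℕ) :
    ∑ j ∈ Finset.range k, X ^ j / j.factorial + X ^ k / k.factorial * (y / S) ≤
      (hornerHi S x k y : ℝ) / S := by
  have hS' : (0 : ℝ) < S := by exact_mod_cast hS
  induction k generalizing y with
  | zero => simp [hornerHi]
  | succ k ih =>
    rw [hornerHi, force_eq, Finset.sum_range_succ, add_assoc]
    refine le_trans (add_le_add le_rfl ?_) (ih _)
    have h1 : 1 + X * (y / S) / (k + 1) ≤ ((S + x * y / (S * (k + 1)) + 1 : ℕ) : ℝ) / S := by
      have h2 : (x * y : ℝ) / (S * (k + 1)) ≤ ((x * y / (S * (k + 1)) : ℕ) : ℝ) + 1 := by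
        exact_mod_cast real_div_le_natCast_div_add_one (x * y) (S * (k + 1))
      have h3 : (x * y : ℝ) / (S * (k + 1)) = x / S * (y / S) / (k + 1) * S := by
        field_simp
      have h4 : X * (y / S) / (k + 1) ≤ (x : ℝ) / S * (y / S) / (k + 1) := by gcongr
      rw [le_div_iff₀ hS']
      push_cast at h2 ⊢
      nlinarith
    calc _ = X ^ k / k.factorial * (1 + X * (y / S) / (k + 1)) := by
          rw [Nat.factorial_succ]; push_cast; field_simp; ring
      _ ≤ _ := by gcongr

theorem logTwoSum_bounds {S : ℕ} (k s : ℕ) :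
    (logTwoSum S k s : ℝ) ≤
        s + S * ∑ i ∈ Finset.range k, (1 / 2 : ℝ) ^ (i + 1) / (i + 1) ∧
      s + S * ∑ i ∈ Finset.range k, (1 / 2 : ℝ) ^ (i + 1) / (i + 1) ≤ logTwoSum S k s + k := by
  induction k generalizing s with
  | zero => simp [logTwoSum]
  | succ k ih =>
    obtain ⟨h1, h2⟩ := ih (s + S / (2 ^ (k + 1) * (k + 1)))
    have e : (S : ℝ) / (2 ^ (k + 1) * (k + 1)) = S * ((1 / 2 : ℝ) ^ (k + 1) / (k + 1)) := by
      rw [one_div_pow]; field_simp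
    have h3 : ((S / (2 ^ (k + 1) * (k + 1)) : ℕ) : ℝ) ≤ S * ((1 / 2 : ℝ) ^ (k + 1) / (k + 1)) := by
      rw [← e]
      exact_mod_cast natCast_div_le_real S (2 ^ (k + 1) * (k + 1))
    have h4 : S * ((1 / 2 : ℝ) ^ (k + 1) / (k + 1)) ≤
        ((S / (2 ^ (k + 1) * (k + 1)) : ℕ) : ℝ) + 1 := by
      rw [← e]
      exact_mod_cast real_div_le_natCast_div_add_one S (2 ^ (k + 1) * (k + 1))
    rw [logTwoSum, force_eq, Finset.sum_range_succ, mul_add (S : ℝ)]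
    rw [Nat.cast_add] at h1 h2
    rw [Nat.cast_succ]
    constructor <;> linarith

theorem logTwoSum_sub_one_bounds {S k : ℕ} (hS : S ≤ 2 ^ k) :
    ((logTwoSum S k 0 - 1 : ℕ) : ℝ) ≤ S * Real.log 2 ∧
      S * Real.log 2 ≤ ((logTwoSum S k 0 - 1 : ℕ) : ℝ) + (k + 2) := by
  obtain ⟨h1, h2⟩ := logTwoSum_bounds (S := S) k 0
  have h3 := Real.abs_log_sub_add_sum_range_le (x := 1 / 2) (by norm_num [abs_lt]) k
  have e : Real.log (1 - 1 / 2) = - Real.log 2 := by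
    rw [show (1 - 1 / 2 : ℝ) = 2⁻¹ by norm_num, Real.log_inv]
  have e2 : |(1 / 2 : ℝ)| ^ (k + 1) / (1 - |1 / 2|) = 1 / 2 ^ k := by
    rw [abs_of_pos (by norm_num), pow_succ, one_div_pow]; ring
  rw [e, e2, abs_le] at h3
  obtain ⟨h3, h4⟩ := h3
  have h5 : (S : ℝ) * (1 / 2 ^ k) ≤ 1 := by
    rw [mul_one_div, div_le_one (by positivity)]
    exact_mod_cast hS
  have hS0 : (0 : ℝ) ≤ S := Nat.cast_nonneg S
  have h6 := mul_le_mul_of_nonneg_left h3 hS0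
  have h7 := mul_le_mul_of_nonneg_left h4 hS0
  rw [Nat.cast_zero, zero_add] at h1 h2
  have h8 : 0 ≤ S * Real.log 2 := mul_nonneg hS0 (Real.log_nonneg one_le_two)
  rcases Nat.eq_zero_or_pos (logTwoSum S k 0) with h0 | h0
  · rw [h0] at h1 h2 ⊢
    rw [Nat.zero_sub, Nat.cast_zero] at *
    constructor <;> linarith
  · rw [Nat.cast_sub h0, Nat.cast_one]
    constructor <;> linarith

theorem le_searchStep (N D Clo Chi Blo Bd Q m : ℕ) : m ≤ searchStep N D Clo Chi Blo Bd Q m := by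
  simp only [searchStep, force_eq, Bool.cond_eq_ite]
  split_ifs
  · exact le_max_left _ _
  · exact le_rfl

/-- A shifted multiple `z + ε * q` of a real `q` keeps its distance from `0`. -/
theorem le_abs_intCast_add_mul {ε q : ℝ} (hε : ε = 1 ∨ ε = -1) {k : ℤ} {s : ℝ} (h1 : k + s ≤ q)
    (h2 : q ≤ k + 1 - s) (z : ℤ) : s ≤ |z + ε * q| := by
  rcases hε with rfl | rfl
  · rcases le_or_gt 0 (z + k) with h | h
    · have : (0 : ℝ) ≤ z + k := by exact_mod_cast h
      exact le_trans (by linarith) (le_abs_self _)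
    · have : (z + k : ℝ) + 1 ≤ 0 := by exact_mod_cast h
      exact le_trans (by linarith) (neg_le_abs _)
  · rcases le_or_gt (z - k) 0 with h | h
    · have : (z - k : ℝ) ≤ 0 := by exact_mod_cast h
      exact le_trans (by linarith) (neg_le_abs _)
    · have : (1 : ℝ) ≤ z - k := by exact_mod_cast h
      exact le_trans (by linarith) (le_abs_self _)

/-- With `P` the integer next to `Q * C`, the integer `Q * w - P * m'` differs from `- ε * Q * B`
by `m' * (Q * C - P)` and `Q` times the value of the linear form. For `m'` below the value of
`searchStep` this is less than the distance of `Q * B` from the integers. -/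
theorem not_lt_searchStep {N D Clo Chi Blo Bd Q m m' : ℕ} {C B ε : ℝ} {w : ℤ} (hD : 0 < D)
    (hClo : Clo ≤ D * C) (hChi : D * C ≤ Chi) (hBlo : Blo ≤ D * B) (hBhi : D * B ≤ Blo + Bd)
    (hε : ε = 1 ∨ ε = -1) (hm : m ≤ m')
    (hw : |w - m' * C + ε * B| ≤ 24 / (max 40000 (N * N * (m' * m')) : ℕ)) :
    ¬ m' < searchStep N D Clo Chi Blo Bd Q m := by
  intro hlt
  simp only [searchStep, force_eq, Bool.cond_eq_ite] at hlt
  split_ifs at hlt with hes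
  swap
  · omega
  have hes := Nat.blt_eq ▸ hes
  set P := (Q * Clo + D / 2) / D with hP
  set η := Q * Chi - P * D + (P * D - Q * Clo) with hη
  set r := Q * Blo % D with hr
  set s := min r (D - (r + Q * Bd)) with hs
  set e := 24 * D * Q / max 40000 (N * N * (m * m)) + 1 with he
  clear_value P η r s e
  have hs0 : 0 < s := (Nat.zero_le _).trans_lt hes
  have hDR : (0 : ℝ) < D := by exact_mod_cast hD
  have hQR : (0 : ℝ) ≤ Q := Nat.cast_nonneg _
  -- the multiplier `m'` is small enough
  have h1 : m' * η ≤ s - e - 1 := by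
    have : m' ≤ (s - e - 1) / η := by
      rcases lt_max_iff.1 hlt with h | h <;> omega
    exact (Nat.mul_le_mul_right _ this).trans (Nat.div_mul_le_self _ _)
  have h1' : (m' * η + e + 1 : ℝ) ≤ s := by
    have : m' * η + e + 1 ≤ s := by omega
    exact_mod_cast this
  -- the error term
  have h2 : D * Q * (24 / (max 40000 (N * N * (m' * m')) : ℕ) : ℝ) ≤ e := by
    have h3 : (0 : ℝ) < (max 40000 (N * N * (m * m)) : ℕ) :=
      Nat.cast_pos.2 (lt_max_of_lt_left (by norm_num))
    have h4 : max 40000 (N * N * (m * m)) ≤ max 40000 (N * N * (m' * m')) := by gcongr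
    have h5 := real_div_le_natCast_div_add_one (24 * D * Q) (max 40000 (N * N * (m * m)))
    calc D * Q * (24 / (max 40000 (N * N * (m' * m')) : ℕ) : ℝ)
        ≤ D * Q * (24 / (max 40000 (N * N * (m * m)) : ℕ) : ℝ) := by gcongr
      _ = ((24 * D * Q : ℕ) : ℝ) / ((max 40000 (N * N * (m * m)) : ℕ) : ℝ) := by
        push_cast; ring
      _ ≤ e := by rw [he]; push_cast at h5 ⊢; exact h5
  -- `η` bounds the distance of `Q * C` from `P`
  have h3 : D * |Q * C - P| ≤ η := by
    have a0 : (D : ℝ) * |Q * C - P| = |D * (Q * C - P)| := by rw [abs_mul, abs_of_pos hDR]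
    rw [a0, abs_le]
    have a1 : (Q * Chi : ℝ) - P * D ≤ ((Q * Chi - P * D : ℕ) : ℝ) := by
      have : Q * Chi ≤ (Q * Chi - P * D) + P * D := by omega
      have : (Q * Chi : ℝ) ≤ ((Q * Chi - P * D : ℕ) : ℝ) + P * D := by exact_mod_cast this
      linarith
    have a2 : (P * D : ℝ) - Q * Clo ≤ ((P * D - Q * Clo : ℕ) : ℝ) := by
      have : P * D ≤ (P * D - Q * Clo) + Q * Clo := by omega
      have : (P * D : ℝ) ≤ ((P * D - Q * Clo : ℕ) : ℝ) + Q * Clo := by exact_mod_cast this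
      linarith
    have a3 : (0 : ℝ) ≤ ((Q * Chi - P * D : ℕ) : ℝ) := Nat.cast_nonneg _
    have a4 : (0 : ℝ) ≤ ((P * D - Q * Clo : ℕ) : ℝ) := Nat.cast_nonneg _
    have a5 := mul_le_mul_of_nonneg_left hClo hQR
    have a6 := mul_le_mul_of_nonneg_left hChi hQR
    rw [hη, Nat.cast_add]
    constructor <;> linarith
  -- `s` bounds the distance of `Q * B` from the integers
  have h4 : (s : ℝ) / D ≤ |((Q * w - P * m' : ℤ) : ℝ) + ε * (Q * B)| := by
    have hdm : (D * (Q * Blo / D : ℕ) + r : ℝ) = Q * Blo := by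
      rw [hr]; exact_mod_cast Nat.div_add_mod (Q * Blo) D
    have b1 := mul_le_mul_of_nonneg_left hBlo hQR
    have b2 := mul_le_mul_of_nonneg_left hBhi hQR
    refine le_abs_intCast_add_mul hε (k := (Q * Blo / D : ℕ)) ?_ ?_ _
    · have : (s : ℝ) ≤ r := by exact_mod_cast (hs ▸ min_le_left _ _ : s ≤ r)
      rw [Int.cast_natCast, ← le_sub_iff_add_le', div_le_iff₀ hDR]
      linarith
    · have : s + (r + Q * Bd) ≤ D := by
        have : s ≤ D - (r + Q * Bd) := hs ▸ min_le_right _ _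
        omega
      have : (s + (r + Q * Bd) : ℝ) ≤ D := by exact_mod_cast this
      rw [Int.cast_natCast, le_sub_comm, div_le_iff₀ hDR]
      linarith
  have h5 : ((Q * w - P * m' : ℤ) : ℝ) + ε * (Q * B) =
      Q * (w - m' * C + ε * B) + m' * (Q * C - P) := by
    push_cast; ring
  have h6 : |Q * (w - m' * C + ε * B) + m' * (Q * C - P)| ≤
      Q * (24 / (max 40000 (N * N * (m' * m')) : ℕ)) + m' * |Q * C - P| := by
    refine (abs_add_le _ _).trans ?_
    rw [abs_mul, abs_mul, abs_of_nonneg hQR, abs_of_nonneg (Nat.cast_nonneg (α := ℝ) m')]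
    gcongr
  rw [h5] at h4
  have h7 := (div_le_iff₀ hDR).1 (h4.trans h6)
  have h8 : (m' : ℝ) * (D * |Q * C - P|) ≤ m' * η := by gcongr
  linarith

theorem exists_of_euclid {t : ℕ} {f : ℕ → ℕ → ℕ → ℕ → Bool} {k a b Q₀ Q : ℕ}
    (h : euclid t f k a b Q₀ Q = true) : ∃ a b Q₀ Q, f a b Q₀ Q = true := by
  induction k generalizing a b Q₀ Q with
  | zero => exact ⟨_, _, _, _, h⟩
  | succ k ih =>
    change (bif Nat.ble Q t then
      force (Nat.mod a b) fun b' => force (Nat.add Q₀ (Nat.mul (Nat.div a b) Q)) fun Q' =>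
      euclid t f k b b' Q Q'
      else f a b Q₀ Q) = true at h
    rw [force_eq, force_eq] at h
    cases hQ : Nat.ble Q t with
    | true => rw [hQ] at h; exact ih h
    | false => rw [hQ] at h; exact ⟨_, _, _, _, h⟩

/-- The search is sound, whatever the numbers `Q` are that it runs through. -/
theorem not_of_search {L N D Clo Chi Blo Bd q : ℕ} {C B : ℝ} (hD : 0 < D)
    (hClo : Clo ≤ D * C) (hChi : D * C ≤ Chi) (hBlo : Blo ≤ D * B) (hBhi : D * B ≤ Blo + Bd)
    {k m t a b Q₀ Q : ℕ} (h : search L N D Clo Chi Blo Bd q k m t a b Q₀ Q = true)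
    {m' : ℕ} {w : ℤ} {ε : ℝ} (hε : ε = 1 ∨ ε = -1) (hm : m ≤ m') (hL : N * m' ≤ L) :
    ¬ |w - m' * C + ε * B| ≤ 24 / (max 40000 (N * N * (m' * m')) : ℕ) := by
  intro hw
  induction k generalizing m t a b Q₀ Q with
  | zero => simp [search] at h
  | succ k ih =>
    rw [search] at h
    obtain ⟨a, b, Q₀, Q, h⟩ := exists_of_euclid h
    simp only [force_eq] at h
    have h1 := not_lt.1 (not_lt_searchStep (Q := Q) hD hClo hChi hBlo hBhi hε hm hw)
    cases hb : Nat.blt L (N * searchStep N D Clo Chi Blo Bd Q m) with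
    | true =>
      have h2 := Nat.blt_eq ▸ hb
      exact absurd (Nat.mul_le_mul_left N h1) (by omega)
    | false =>
      rw [hb] at h
      exact ih h h1

/-! ### Enclosures of the coefficients of the linear form -/

theorem hornerLo_div_le_exp {S x T : ℕ} (hS : 0 < S) {X : ℝ} (hx : (x : ℝ) / S ≤ X) :
    (hornerLo S x T S : ℝ) / S ≤ Real.exp X := by
  have hX : 0 ≤ X := le_trans (by positivity) hx
  have hS' : (S : ℝ) ≠ 0 := by positivity
  refine (hornerLo_div_le hS hx T S).trans ?_
  rw [div_self hS', mul_one, ← Finset.sum_range_succ (fun j => X ^ j / (j.factorial : ℝ))]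
  exact Real.sum_le_exp_of_nonneg hX _

theorem exp_le_hornerHi_div {S x T : ℕ} (hS : 0 < S) (hT : 0 < T) {X : ℝ} (hX : 0 ≤ X)
    (hX1 : X ≤ 1) (hx : X ≤ (x : ℝ) / S) :
    Real.exp X ≤ (hornerHi S x T (2 * S) : ℝ) / S := by
  have hS' : (S : ℝ) ≠ 0 := by positivity
  refine le_trans ?_ (le_hornerHi_div hS hX hx T (2 * S))
  refine (Real.exp_bound' hX hX1 hT).trans (add_le_add le_rfl ?_)
  have hT' : (1 : ℝ) ≤ T := by exact_mod_cast hT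
  have : ((2 * S : ℕ) : ℝ) / S = 2 := by push_cast; field_simp
  rw [this, div_mul_eq_div_div, mul_div_right_comm, ← mul_div]
  gcongr
  rw [div_le_iff₀ (by linarith)]
  linarith

/-- The coefficient of the sign `ε` in the linear form `w - m * formSlope N + ε * formShift N`. -/
noncomputable def formShift (N : ℕ) : ℝ := 2 / (N * Real.sinh (Real.log 2 / N))

/-- The coefficient `coth (log 2 / N)` of `m` in the linear form. -/
noncomputable def formSlope (N : ℕ) : ℝ := Real.cosh (Real.log 2 / N) / Real.sinh (Real.log 2 / N)

theorem cosh_div_sinh_eq {x : ℝ} :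
    Real.cosh x / Real.sinh x = (Real.exp x ^ 2 + 1) / (Real.exp x ^ 2 - 1) := by
  have h := (Real.exp_pos x).ne'
  rw [Real.cosh_eq, Real.sinh_eq, Real.exp_neg, ← mul_div_mul_right _ _ (mul_ne_zero two_ne_zero h)]
  congr 1 <;> field_simp

theorem two_div_mul_sinh_eq {N x : ℝ} :
    2 / (N * Real.sinh x) = 4 * Real.exp x / (N * (Real.exp x ^ 2 - 1)) := by
  have h := (Real.exp_pos x).ne'
  rw [Real.sinh_eq, Real.exp_neg, ← mul_div_mul_right _ _ (mul_ne_zero two_ne_zero h)]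
  congr 1
  · ring
  · field_simp

/-- Enclosures of the coefficients of the linear form from an enclosure of `τ`: both are decreasing
functions of `τ`. -/
theorem coeff_bounds {S y z : ℕ} (D N : ℕ) {τ : ℝ} (hS : 0 < S) (hN : 0 < N) (h1 : S < y)
    (hyτ : (y : ℝ) ≤ S * τ) (hτz : S * τ ≤ z) :
    ((((z * z + S * S) * D / (z * z - S * S) : ℕ) : ℝ) ≤ D * ((τ ^ 2 + 1) / (τ ^ 2 - 1)) ∧
      D * ((τ ^ 2 + 1) / (τ ^ 2 - 1)) ≤
        (((y * y + S * S) * D / (y * y - S * S) + 1 : ℕ) : ℝ)) ∧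
    (((4 * z * S * D / (N * (z * z - S * S)) : ℕ) : ℝ) ≤ D * (4 * τ / (N * (τ ^ 2 - 1))) ∧
      D * (4 * τ / (N * (τ ^ 2 - 1))) ≤
        ((4 * y * S * D / (N * (y * y - S * S)) + 1 : ℕ) : ℝ)) := by
  have hS' : (0 : ℝ) < S := by exact_mod_cast hS
  have hN0 : (0 : ℝ) < N := by exact_mod_cast hN
  have hy1 : (S : ℝ) < y := by exact_mod_cast h1
  have hτ : 1 < τ := by nlinarith
  have e1 : ((y * y - S * S : ℕ) : ℝ) = y * y - S * S := by
    rw [Nat.cast_sub (Nat.mul_le_mul h1.le h1.le)]; push_cast; ring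
  have hzy : y ≤ z := by exact_mod_cast hyτ.trans hτz
  have e2 : ((z * z - S * S : ℕ) : ℝ) = z * z - S * S := by
    rw [Nat.cast_sub (Nat.mul_le_mul (h1.le.trans hzy) (h1.le.trans hzy))]; push_cast; ring
  have hDR : (0 : ℝ) ≤ D := Nat.cast_nonneg D
  have p1 : 0 < (y * y - S * S : ℝ) := by nlinarith
  have p2 : 0 < (z * z - S * S : ℝ) := by nlinarith
  have p3 : 0 < τ ^ 2 - 1 := by nlinarith
  have q1 : (S * τ) * (S * τ) ≤ z * z := by gcongr
  have q2 : (y : ℝ) * y ≤ (S * τ) * (S * τ) := by gcongr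
  refine ⟨⟨?_, ?_⟩, ?_, ?_⟩
  · refine (natCast_div_le_real _ _).trans ?_
    rw [e2]
    push_cast
    rw [mul_div_assoc', div_le_div_iff₀ p2 p3]
    have : (z * z + S * S : ℝ) * (τ ^ 2 - 1) ≤ (τ ^ 2 + 1) * (z * z - S * S) := by linarith
    have := mul_le_mul_of_nonneg_left this hDR
    linarith
  · rw [Nat.cast_succ]
    refine le_trans ?_ (real_div_le_natCast_div_add_one _ _)
    rw [e1]
    push_cast
    rw [mul_div_assoc', div_le_div_iff₀ p3 p1]
    have : (τ ^ 2 + 1) * (y * y - S * S) ≤ (y * y + S * S : ℝ) * (τ ^ 2 - 1) := by linarith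
    have := mul_le_mul_of_nonneg_left this hDR
    linarith
  · refine (natCast_div_le_real _ _).trans ?_
    push_cast [e2]
    rw [mul_div_assoc', div_le_div_iff₀ (by positivity) (by positivity)]
    -- the difference of the two sides is `(z - S * τ) * (τ * z + S)`
    have : (z * S : ℝ) * (τ ^ 2 - 1) ≤ τ * (z * z - S * S) := by
      linarith [mul_nonneg (sub_nonneg.2 hτz) (by positivity : 0 ≤ τ * z + S)]
    have := mul_le_mul_of_nonneg_left this (by positivity : (0 : ℝ) ≤ 4 * D * N)
    linarith
  · rw [Nat.cast_succ]
    refine le_trans ?_ (real_div_le_natCast_div_add_one _ _)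
    push_cast [e1]
    rw [mul_div_assoc', div_le_div_iff₀ (by positivity) (by positivity)]
    have : τ * (y * y - S * S : ℝ) ≤ y * S * (τ ^ 2 - 1) := by
      linarith [mul_nonneg (sub_nonneg.2 hyτ) (by positivity : 0 ≤ τ * y + S)]
    have := mul_le_mul_of_nonneg_left this (by positivity : (0 : ℝ) ≤ 4 * D * N)
    linarith

/-- A successful `check` bounds the linear form for the exponent `2 ^ k - 1` away from `0`. -/
theorem not_of_check {S l k : ℕ} (hS : 0 < S) (hl : (l : ℝ) ≤ S * Real.log 2)
    (hl' : S * Real.log 2 ≤ (l : ℝ) + 4000) (hk : 0 < k) (h : check S l k = true)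
    {m : ℕ} {w : ℤ} {ε : ℝ} (hε : ε = 1 ∨ ε = -1) (hm : 1 ≤ m)
    (hL : (2 ^ k - 1) * m ≤ 204 * 10 ^ 498) :
    ¬ |w - m * formSlope (2 ^ k - 1) + ε * formShift (2 ^ k - 1)| ≤
      24 / (max 40000 ((2 ^ k - 1) * (2 ^ k - 1) * (m * m)) : ℕ) := by
  simp only [check, force_eq, Bool.and_eq_true] at h
  have hN : 0 < 2 ^ k - 1 := Nat.sub_pos_of_lt (Nat.one_lt_two_pow hk.ne')
  generalize 204 * 10 ^ 498 = L at *
  generalize 2 ^ k - 1 = N at *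
  have hT : 0 < 3500 / (k - 1) + 20 := Nat.succ_pos _
  generalize 3500 / (k - 1) + 20 = T at *
  have hD : 0 < 2 ^ (2 * (1661 - k) + 64) := by positivity
  generalize 2 ^ (2 * (1661 - k) + 64) = D at *
  obtain ⟨h1, h2⟩ := h
  have h1 := Nat.blt_eq ▸ h1
  have hN' : (1 : ℝ) ≤ N := by exact_mod_cast hN
  have hN0 : (0 : ℝ) < N := by linarith
  have hlog := Real.log_pos one_lt_two
  have hlog1 : Real.log 2 ≤ 1 := by linarith [Real.log_two_lt_d9]
  have hS' : (0 : ℝ) < S := by exact_mod_cast hS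
  have hX : 0 < Real.log 2 / N := by positivity
  have hX1 : Real.log 2 / N ≤ 1 := by rw [div_le_one hN0]; linarith
  have hy := hornerLo_div_le_exp (T := T) hS (x := l / N) (X := Real.log 2 / N) (by
    rw [div_le_iff₀ hS']
    refine (natCast_div_le_real _ _).trans ?_
    rw [div_mul_eq_mul_div, mul_comm]
    gcongr)
  have hz := exp_le_hornerHi_div hS hT hX.le hX1 (x := (l + 4000) / N + 1) (by
    rw [le_div_iff₀ hS', Nat.cast_succ]
    refine le_trans ?_ (real_div_le_natCast_div_add_one _ _)
    rw [div_mul_eq_mul_div, mul_comm]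
    push_cast
    gcongr)
  generalize hornerLo S (l / N) T S = y at *
  generalize hornerHi S ((l + 4000) / N + 1) T (2 * S) = z at *
  rw [formShift, formSlope, cosh_div_sinh_eq, two_div_mul_sinh_eq]
  generalize Real.exp (Real.log 2 / N) = τ at *
  obtain ⟨⟨b1, b2⟩, b3, b4⟩ := coeff_bounds D N hS hN h1
    ((div_le_iff₀' hS').1 hy) ((le_div_iff₀' hS').1 hz)
  refine not_of_search hD b1 b2 b3 (b4.trans ?_) h2 hε hm hL
  rw [← Nat.cast_add]
  exact Nat.cast_le.2 le_add_tsub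

/-! ### The linear form -/

theorem natCast_mul_sinh_le {x : ℝ} (hx : 0 ≤ x) (k : ℕ) : k * Real.sinh x ≤ Real.sinh (k * x) := by
  induction k with
  | zero => simp
  | succ k ih =>
    have h1 : 0 ≤ Real.sinh x := Real.sinh_nonneg_iff.2 hx
    have h2 : 0 ≤ Real.sinh (k * x) := Real.sinh_nonneg_iff.2 (by positivity)
    have h3 := Real.one_le_cosh x
    have h4 := Real.one_le_cosh (k * x)
    rw [Nat.cast_succ, add_mul, add_mul, one_mul, one_mul, Real.sinh_add]
    nlinarith

theorem sinh_natCast_mul_le {x : ℝ} (hx : 0 ≤ x) (k : ℕ) :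
    Real.sinh (k * x) ≤ k * Real.sinh x * Real.cosh (k * x) := by
  induction k with
  | zero => simp
  | succ k ih =>
    have h1 : 0 ≤ Real.sinh x := Real.sinh_nonneg_iff.2 hx
    have h2 : 0 ≤ Real.sinh (k * x) := Real.sinh_nonneg_iff.2 (by positivity)
    have h3 := Real.one_le_cosh x
    have h4 := Real.one_le_cosh (k * x)
    have e1 : ((k + 1 : ℕ) : ℝ) * x = k * x + x := by push_cast; ring
    have h5 : Real.cosh (k * x) * Real.cosh x ≤ Real.cosh (k * x + x) := by
      rw [Real.cosh_add]; nlinarith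
    have h6 : Real.cosh (k * x) ≤ Real.cosh (k * x + x) := by nlinarith
    rw [e1, Real.sinh_add, Nat.cast_succ]
    calc Real.sinh (k * x) * Real.cosh x + Real.cosh (k * x) * Real.sinh x
        ≤ k * Real.sinh x * Real.cosh (k * x) * Real.cosh x +
          Real.cosh (k * x) * Real.sinh x := by gcongr
      _ = k * Real.sinh x * (Real.cosh (k * x) * Real.cosh x) +
          Real.cosh (k * x) * Real.sinh x := by ring
      _ ≤ k * Real.sinh x * Real.cosh (k * x + x) + Real.cosh (k * x + x) * Real.sinh x := by
        gcongr
      _ = _ := by ring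

theorem sinh_log_two : Real.sinh (Real.log 2) = 3 / 4 := by
  rw [Real.sinh_eq, Real.exp_neg, Real.exp_log two_pos]; norm_num

theorem exists_exp_param {P S : ℝ} (hP : 0 < P) (hS : 0 < S) :
    ∃ r y : ℝ, 0 < r ∧ P = r * Real.exp y ∧ S = r * Real.exp (-y) := by
  refine ⟨Real.exp ((Real.log P + Real.log S) / 2), (Real.log P - Real.log S) / 2,
    Real.exp_pos _, ?_, ?_⟩
  · rw [← Real.exp_add]; ring_nf; exact (Real.exp_log hP).symm
  · rw [← Real.exp_add]; ring_nf; exact (Real.exp_log hS).symm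

/-- If `P ^ N - S ^ N` is as small as `2 * u * (P * S) ^ (M + 1)`, where `N = 2 * M + 1`, then `P`
and `S` differ by less than `2`. -/
theorem sub_lt_two_of_pow_sub_pow {M : ℕ} (hM : 1 ≤ M) {P S u : ℝ} (hP : 0 < P) (hS : 0 < S)
    (hc : 5 ≤ P * S) (hu1 : 1 ≤ u * (P * S)) (hu2 : u * (P * S) ≤ 1 + 2 / (P * S))
    (h : P ^ (2 * M + 1) - S ^ (2 * M + 1) = 2 * (u * (P * S) ^ (M + 1))) :
    P - S < 2 := by
  obtain ⟨r, y, hr, rfl, rfl⟩ := exists_exp_param hP hS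
  have hrr : r * Real.exp y * (r * Real.exp (-y)) = r ^ 2 := by
    rw [mul_mul_mul_comm, ← Real.exp_add, add_neg_cancel, Real.exp_zero]; ring
  rw [hrr] at hc hu1 hu2 h
  have h1 : r ^ (2 * M + 1) * Real.sinh ((2 * M + 1 : ℕ) * y) = r ^ (2 * M + 1) * (u * r) := by
    rw [Real.sinh_eq, ← mul_neg, Real.exp_nat_mul, Real.exp_nat_mul]
    rw [mul_pow, mul_pow] at h
    linear_combination h / 2
  have h2 := mul_left_cancel₀ (pow_pos hr _).ne' h1
  have hu0 : 0 < u := by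
    by_contra hu
    nlinarith
  have hy : 0 ≤ y := by
    have : 0 < Real.sinh ((2 * M + 1 : ℕ) * y) := by rw [h2]; positivity
    rw [Real.sinh_pos_iff] at this
    exact (pos_of_mul_pos_right this (Nat.cast_nonneg _)).le
  have h3 := natCast_mul_sinh_le hy (2 * M + 1)
  rw [h2] at h3
  have h4 : r * Real.exp y - r * Real.exp (-y) = 2 * (r * Real.sinh y) := by
    rw [Real.sinh_eq]; ring
  rw [h4]
  have h5 : (3 : ℝ) ≤ (2 * M + 1 : ℕ) := by
    have : 3 ≤ 2 * M + 1 := by omega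
    exact_mod_cast this
  have h6 : 0 ≤ Real.sinh y := Real.sinh_nonneg_iff.2 hy
  have h7 : 3 * (r * Real.sinh y) ≤ u * r ^ 2 := by nlinarith
  have h8 : 2 / r ^ 2 ≤ 2 / 5 := by gcongr
  linarith

/-- The size of `sinh z` when `sinh (N * z) = u * r` and `u` is close to `1 / r ^ 2`. -/
theorem sinh_bounds {N : ℕ} {r u z : ℝ} (hN0 : (0 : ℝ) < N) (hr : 0 < r) (hc : 6 ≤ r ^ 2)
    (hu1 : 1 ≤ u * r ^ 2) (hu2 : u * r ^ 2 ≤ 1 + 2 / r ^ 2) (h2 : Real.sinh (N * z) = u * r) :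
    0 ≤ z ∧ z < Real.log 2 / N ∧ |N * (2 * r * Real.sinh z) - 2| ≤ 4 / r ^ 2 := by
  have hu0 : 0 < u := by
    by_contra hu
    nlinarith
  have hy : 0 ≤ z := by
    have : 0 < Real.sinh (N * z) := by rw [h2]; positivity
    rw [Real.sinh_pos_iff] at this
    exact (pos_of_mul_pos_right this hN0.le).le
  have h3 := natCast_mul_sinh_le hy N
  have h4 := sinh_natCast_mul_le hy N
  have h5 := Real.cosh_sq (N * z)
  rw [h2] at h3 h4 h5
  have hr2 : 0 < r ^ 2 := by positivity
  have hv : 2 / r ^ 2 ≤ 2 / 6 := by gcongr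
  have hv2 : u * r ^ 2 ≤ 4 / 3 := by linarith
  have h6 : (u * r) ^ 2 = (u * r ^ 2) ^ 2 / r ^ 2 := by field_simp
  have h7 : (u * r) ^ 2 ≤ (4 / 3) ^ 2 / r ^ 2 := by rw [h6]; gcongr
  have h8 : Real.cosh (N * z) ≤ 1 + 1 / r ^ 2 := by
    refine abs_le_of_sq_le_sq' ?_ (by positivity) |>.2
    have h9 : 0 < 1 / r ^ 2 := by positivity
    have e : (4 / 3 : ℝ) ^ 2 / r ^ 2 = 16 / 9 * (1 / r ^ 2) := by ring
    rw [h5]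
    rw [e] at h7
    linarith [mul_pos h9 h9]
  have hs0 : 0 ≤ Real.sinh z := Real.sinh_nonneg_iff.2 hy
  have hup : N * (2 * r * Real.sinh z) ≤ 2 + 4 / r ^ 2 := by
    have e : (4 : ℝ) / r ^ 2 = 2 * (2 / r ^ 2) := by ring
    have a1 := mul_le_mul_of_nonneg_right h3 hr.le
    linarith
  have hlo : 2 - 4 / r ^ 2 ≤ N * (2 * r * Real.sinh z) := by
    have a1 : u * r * r ≤ N * Real.sinh z * (1 + 1 / r ^ 2) * r := by
      refine mul_le_mul_of_nonneg_right (h4.trans ?_) hr.le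
      gcongr
    have e : (4 : ℝ) / r ^ 2 = 4 * (1 / r ^ 2) := by ring
    have a2 : 0 < 1 / r ^ 2 := by positivity
    rw [e]
    set t := 1 / r ^ 2
    clear_value t
    by_contra hcon
    push Not at hcon
    have a3 : N * (2 * r * Real.sinh z) * (1 + t) < (2 - 4 * t) * (1 + t) :=
      mul_lt_mul_of_pos_right hcon (by linarith)
    have a4 : 0 < t * t := mul_pos a2 a2
    linarith
  refine ⟨hy, ?_, by rw [abs_le]; constructor <;> linarith⟩
  have a1 : u * r < 3 / 4 := by
    refine abs_lt_of_sq_lt_sq' ?_ (by norm_num) |>.2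
    have : (4 / 3 : ℝ) ^ 2 / r ^ 2 ≤ (4 / 3) ^ 2 / 6 := by gcongr
    norm_num at this ⊢
    linarith
  rw [← h2, ← sinh_log_two, Real.sinh_lt_sinh] at a1
  rwa [lt_div_iff₀' hN0]

/-- The equation `E ^ N / 4 - d ^ N = ± a` makes a linear form in `w = E + d` and `m = E - d`
small: with `E = r * exp y`, `d = r * exp (-y)` and `x = y - log 2 / N` it says
`sinh (N * x) = ± u * r`, and `2 * r * sinh x` is `m * cosh (log 2 / N) - w * sinh (log 2 / N)`.
-/
theorem linear_form {M : ℕ} (hM : 1 ≤ M) {E d u ε : ℝ} (hE : 0 < E) (hd : 0 < d)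
    (hε : ε = 1 ∨ ε = -1) (hc : 6 ≤ E * d) (hu1 : 1 ≤ u * (E * d))
    (hu2 : u * (E * d) ≤ 1 + 2 / (E * d))
    (h : E ^ (2 * M + 1) / 4 - d ^ (2 * M + 1) = ε * (u * (E * d) ^ (M + 1))) :
    d < E ∧
    |E + d - (E - d) * formSlope (2 * M + 1) + ε * formShift (2 * M + 1)| ≤ 5.78 / (E * d) ∧
    (2 * M + 1) * (E - d) ≤ 2 * √(E * d) + 3.6 := by
  obtain ⟨r, y, hr, hEr, hdr⟩ := exists_exp_param hE hd
  have hrr : E * d = r ^ 2 := by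
    rw [hEr, hdr, mul_mul_mul_comm, ← Real.exp_add, add_neg_cancel, Real.exp_zero]; ring
  rw [hrr] at hc hu1 hu2 h ⊢
  rw [Real.sqrt_sq hr.le]
  have hN3 : (3 : ℝ) ≤ (2 * M + 1 : ℕ) := by
    have : 3 ≤ 2 * M + 1 := by omega
    exact_mod_cast this
  have hNe : (2 * M + 1 : ℝ) = (2 * M + 1 : ℕ) := by push_cast; ring
  rw [hNe]
  have hε2 : ε * ε = 1 := by rcases hε with rfl | rfl <;> norm_num
  -- `2 * r * sinh x` is the linear form up to a factor
  obtain ⟨x, hx⟩ : ∃ x, y = Real.log 2 / (2 * M + 1 : ℕ) + x := ⟨_, (add_sub_cancel _ _).symm⟩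
  have h1 : Real.sinh ((2 * M + 1 : ℕ) * x) = ε * (u * r) := by
    refine mul_left_cancel₀ (pow_pos hr (2 * M + 1)).ne' ?_
    have e1 : (2 * M + 1 : ℕ) * x = (2 * M + 1 : ℕ) * y - Real.log 2 := by
      rw [hx]; field_simp; ring
    rw [e1, Real.sinh_eq, neg_sub, Real.exp_sub, Real.exp_sub, Real.exp_log two_pos,
      Real.exp_nat_mul, div_eq_mul_inv 2 (Real.exp y ^ _), ← inv_pow, ← Real.exp_neg]
    rw [hEr, hdr, mul_pow, mul_pow] at h
    linear_combination h
  have hlin : 2 * r * Real.sinh x = (E - d) * Real.cosh (Real.log 2 / (2 * M + 1 : ℕ)) -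
      (E + d) * Real.sinh (Real.log 2 / (2 * M + 1 : ℕ)) := by
    have e1 : x = y - Real.log 2 / (2 * M + 1 : ℕ) := by rw [hx]; ring
    have e2 : E - d = 2 * r * Real.sinh y := by rw [hEr, hdr, Real.sinh_eq]; ring
    have e3 : E + d = 2 * r * Real.cosh y := by rw [hEr, hdr, Real.cosh_eq]; ring
    rw [e2, e3, e1, Real.sinh_sub]; ring
  obtain ⟨z, hz⟩ : ∃ z, x = ε * z := ⟨ε * x, by rw [← mul_assoc, hε2, one_mul]⟩
  have hsε : ∀ t, Real.sinh (ε * t) = ε * Real.sinh t := by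
    intro t
    rcases hε with rfl | rfl
    · simp
    · simp
  have h2 : Real.sinh ((2 * M + 1 : ℕ) * z) = u * r := by
    rw [hz, mul_left_comm, hsε] at h1
    refine mul_left_cancel₀ (a := ε) ?_ h1
    rintro rfl
    simp at hε2
  rw [hz, hsε] at hlin
  rw [formSlope, formShift]
  generalize hN : (2 * M + 1 : ℕ) = N at *
  have hN0 : (0 : ℝ) < N := by linarith
  have hlog := Real.log_pos one_lt_two
  have hh : 0 < Real.log 2 / N := by positivity
  obtain ⟨hz0, hzlog, hza⟩ := sinh_bounds hN0 hr hc hu1 hu2 h2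
  have hy0 : 0 < y := by
    have : 0 < Real.log 2 / N + z := add_pos_of_pos_of_nonneg hh hz0
    rcases hε with rfl | rfl <;> linarith
  refine ⟨?_, ?_, ?_⟩
  · rw [hEr, hdr]
    gcongr
    linarith
  · have a1 : Real.log 2 ≤ N * Real.sinh (Real.log 2 / N) := by
      have := Real.self_le_sinh_iff.2 hh.le
      rwa [div_le_iff₀' hN0] at this
    have a2 : 0 < Real.sinh (Real.log 2 / N) := Real.sinh_pos_iff.2 hh
    have e1 : E + d - (E - d) * (Real.cosh (Real.log 2 / N) / Real.sinh (Real.log 2 / N)) +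
        ε * (2 / (N * Real.sinh (Real.log 2 / N))) =
        -(ε * (N * (2 * r * Real.sinh z) - 2)) / (N * Real.sinh (Real.log 2 / N)) := by
      field_simp
      linear_combination (N : ℝ) * hlin
    rw [e1, abs_div, abs_neg, abs_mul, abs_of_pos (mul_pos hN0 a2)]
    have e2 : |ε| = 1 := by rcases hε with rfl | rfl <;> simp
    rw [e2, one_mul, div_le_iff₀ (mul_pos hN0 a2)]
    refine hza.trans ?_
    rw [div_mul_eq_mul_div]
    gcongr
    -- the constant `5.78` is `4 / log 2`, rounded up
    have := Real.log_two_gt_d9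
    norm_num
    linarith
  · have a1 := natCast_mul_sinh_le hh.le N
    rw [mul_div_cancel₀ _ hN0.ne', sinh_log_two] at a1
    have a2 := Real.one_le_cosh (Real.log 2 / N)
    have a3 : d ≤ r := by
      rw [hdr]
      exact mul_le_of_le_one_right hr.le (Real.exp_le_one_iff.2 (by linarith))
    have a4 : (2 : ℝ) / r ^ 2 ≤ 2 / 6 := by gcongr
    have a5 : d ≤ E := by
      rw [hEr, hdr]
      gcongr
      linarith
    have a6 : N * (ε * (2 * r * Real.sinh z)) ≤ 8 / 3 := by
      have e : (4 : ℝ) / r ^ 2 = 2 * (2 / r ^ 2) := by ring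
      have := abs_le.1 hza
      rcases hε with rfl | rfl <;> linarith
    have a7 : (E - d) * 1 ≤ (E - d) * Real.cosh (Real.log 2 / N) :=
      mul_le_mul_of_nonneg_left a2 (by linarith)
    have a8 : N * (E - d) ≤ 3 / 4 * (E + d) + 8 / 3 := by
      have b1 := mul_le_mul_of_nonneg_left a1 (by linarith : 0 ≤ E + d)
      have b2 := mul_le_mul_of_nonneg_left a7 hN0.le
      have b3 := congrArg (fun t : ℝ => N * t) hlin
      linarith
    have a9 := mul_le_mul_of_nonneg_right hN3 (by linarith : 0 ≤ E - d)
    linarith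

/-! ### The critical orbit -/

/-- The numerators `a k` of the critical orbit of `x ^ 2 + 1 / c`: the value `f^[k + 1] 0` is
`a k / c ^ 2 ^ k`. -/
def orbitNum (c : ℕ) : ℕ → ℕ
  | 0 => 1
  | k + 1 => orbitNum c k ^ 2 + c ^ (2 ^ (k + 1) - 1)

theorem two_pow_succ_sub_one (k : ℕ) : 2 ^ (k + 1) - 1 = 2 * (2 ^ k - 1) + 1 := by
  have := Nat.one_le_two_pow (n := k)
  rw [pow_succ]; omega

theorem orbitNum_mod_three {c : ℕ} (hc : c % 3 = 1) (k : ℕ) : orbitNum c (k + 1) % 3 = 2 := by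
  have h (n : ℕ) : c ^ n % 3 = 1 := by rw [Nat.pow_mod, hc, one_pow]; rfl
  induction k with
  | zero => simp [orbitNum, Nat.add_mod, hc]
  | succ k ih => rw [orbitNum, Nat.add_mod, h, Nat.pow_mod, ih]

theorem orbitNum_two_mod_five (k : ℕ) :
    orbitNum 2 (k + 2) % 5 = 2 ∧ 2 ^ (2 ^ (k + 2) - 1) % 5 = 3 := by
  induction k with
  | zero => decide
  | succ k ih =>
    have h : 2 ^ (2 ^ (k + 1 + 2) - 1) % 5 = 3 := by
      rw [show k + 1 + 2 = (k + 2) + 1 by ring, two_pow_succ_sub_one, pow_succ, mul_comm 2, pow_mul,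
        Nat.mul_mod, Nat.pow_mod, ih.2]
    refine ⟨?_, h⟩
    rw [show k + 1 + 2 = (k + 2) + 1 by ring] at h ⊢
    rw [orbitNum, Nat.add_mod, h, Nat.pow_mod, ih.1]

theorem orbitNum_three_mod_eleven (k : ℕ) :
    (orbitNum 3 (k + 2) % 11, 3 ^ (2 ^ (k + 2) - 1) % 11) ∈
      ({(10, 5), (10, 9), (2, 1), (7, 3)} : Finset (ℕ × ℕ)) := by
  induction k with
  | zero => decide
  | succ k ih =>
    have h : 3 ^ (2 ^ (k + 2 + 1) - 1) % 11 = (3 ^ (2 ^ (k + 2) - 1) % 11) ^ 2 * 3 % 11 := by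
      rw [two_pow_succ_sub_one, pow_succ, mul_comm 2, pow_mul, Nat.mul_mod, Nat.pow_mod]
      simp [Nat.mul_mod]
    rw [show k + 1 + 2 = (k + 2) + 1 by ring, orbitNum, Nat.add_mod, Nat.pow_mod, h]
    simp only [Finset.mem_insert, Finset.mem_singleton, Prod.mk.injEq] at ih
    rcases ih with ⟨h1, h2⟩ | ⟨h1, h2⟩ | ⟨h1, h2⟩ | ⟨h1, h2⟩ <;> rw [h1, h2] <;> decide

theorem not_isSquare_of_mod {a p r : ℕ} (h : a % p = r) (hr : ∀ x < p, x * x % p ≠ r) (hp : 0 < p) :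
    ¬ IsSquare a := by
  rintro ⟨x, rfl⟩
  exact hr (x % p) (Nat.mod_lt _ hp) (by rw [← Nat.mul_mod, h])

theorem not_isSquare_orbitNum_of_lt_five {c k : ℕ} (hc : 1 ≤ c) (hc5 : c < 5) (hk : 2 ≤ k) :
    ¬ IsSquare (orbitNum c k) := by
  obtain ⟨k, rfl⟩ := Nat.exists_eq_add_of_le' hk
  interval_cases c
  · exact not_isSquare_of_mod (orbitNum_mod_three (by rfl) (k + 1)) (by decide) (by decide)
  · exact not_isSquare_of_mod (orbitNum_two_mod_five k).1 (by decide) (by decide)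
  · have h := orbitNum_three_mod_eleven k
    simp only [Finset.mem_insert, Finset.mem_singleton, Prod.mk.injEq] at h
    rcases h with ⟨h1, -⟩ | ⟨h1, -⟩ | ⟨h1, -⟩ | ⟨h1, -⟩ <;>
      exact not_isSquare_of_mod h1 (by decide) (by decide)
  · exact not_isSquare_of_mod (orbitNum_mod_three (by rfl) (k + 1)) (by decide) (by decide)

theorem coprime_orbitNum (c k : ℕ) : (orbitNum c k).Coprime c := by
  induction k with
  | zero => exact Nat.coprime_one_left c
  | succ k ih =>
    rw [orbitNum, two_pow_succ_sub_one, pow_succ c, Nat.coprime_add_mul_right_left]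
    exact ih.pow_left 2

/-- For `c ≥ 5` the critical orbit stays close to `1 / c`. -/
theorem orbitNum_bounds {c : ℕ} (hc : 5 ≤ c) (k : ℕ) :
    1 ≤ (orbitNum c k / c ^ 2 ^ k : ℝ) * c ∧
      (orbitNum c k / c ^ 2 ^ k : ℝ) * c ≤ 1 + 2 / c := by
  have hc' : (5 : ℝ) ≤ c := by exact_mod_cast hc
  have hc0 : (0 : ℝ) < c := by linarith
  induction k with
  | zero =>
    have : (0 : ℝ) ≤ 2 / c := by positivity
    simp [orbitNum, hc0.ne', this]
  | succ k ih =>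
    have e : (orbitNum c (k + 1) / c ^ 2 ^ (k + 1) : ℝ) * c =
        ((orbitNum c k / c ^ 2 ^ k : ℝ) * c) ^ 2 / c + 1 := by
      have h : (c : ℝ) ^ (2 ^ (k + 1) - 1) * c = c ^ 2 ^ (k + 1) := by
        rw [← pow_succ, Nat.sub_add_cancel Nat.one_le_two_pow]
      rw [orbitNum, Nat.cast_add, add_div, add_mul, Nat.cast_pow, Nat.cast_pow,
        div_mul_eq_mul_div ((c : ℝ) ^ _), h,
        div_self (by positivity), pow_succ 2 k, pow_mul]
      field_simp
    obtain ⟨h1, h2⟩ := ih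
    rw [e]
    generalize (orbitNum c k / c ^ 2 ^ k : ℝ) * c = v at *
    have h3 : v ^ 2 ≤ 2 := by
      have : 2 / (c : ℝ) ≤ 2 / 5 := by gcongr
      nlinarith
    constructor
    · have : 0 ≤ v ^ 2 / c := by positivity
      linarith
    · have : v ^ 2 / c ≤ 2 / c := by gcongr
      linarith

/-- If a product of coprime numbers is a `N`-th power, so are the factors. -/
theorem exists_pow_of_coprime_mul {x y c N : ℕ} (hN : N ≠ 0) (hxy : x.Coprime y)
    (h : x * y = c ^ N) : ∃ d e : ℕ, x = d ^ N ∧ y = e ^ N ∧ d * e = c := by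
  obtain ⟨d, hd⟩ := exists_eq_pow_of_mul_eq_pow (by rwa [Nat.isUnit_iff]) h
  obtain ⟨e, he⟩ := exists_eq_pow_of_mul_eq_pow
    (by rw [Nat.isUnit_iff]; exact hxy.symm) ((mul_comm y x).trans h)
  refine ⟨d, e, hd, he, ?_⟩
  rw [hd, he, ← mul_pow] at h
  exact Nat.pow_left_injective hN h

/-- The two coprime factorizations behind a square `a ^ 2 + c ^ N`: for odd `c` two `N`-th powers
differ by `2 * a`, for even `c` a quarter of an `N`-th power and an `N`-th power differ by `a`. -/
theorem factorizations_of_sq_add_pow_eq_sq {a b c N : ℕ} (hN : N ≠ 0)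
    (hac : a.Coprime c) (h : a ^ 2 + c ^ N = b ^ 2) :
    (∃ d e : ℕ, d * e = c ∧ Odd c ∧ e ^ N = d ^ N + 2 * a) ∨
    ∃ d e : ℕ, d * e = c ∧ Even c ∧ (e ^ N = 4 * d ^ N + 4 * a ∨ e ^ N + 4 * a = 4 * d ^ N) := by
  have hab : a ≤ b := by
    have : a ^ 2 ≤ b ^ 2 := by omega
    exact (Nat.pow_le_pow_iff_left two_ne_zero).1 this
  obtain ⟨x, rfl⟩ := Nat.exists_eq_add_of_le hab
  have hx : x * (x + 2 * a) = c ^ N := by linarith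
  have hacN : a.Coprime (c ^ N) := hac.pow_right N
  rcases Nat.even_or_odd c with hce | hco
  · right
    have hao : Odd a := by
      rw [← Nat.not_even_iff_odd]
      intro hae
      have := Nat.dvd_gcd hae.two_dvd hce.two_dvd
      rw [hac] at this
      omega
    have hcN : Even (c ^ N) := hce.pow_of_ne_zero hN
    have hxe : Even x := by
      rw [← hx, Nat.even_mul] at hcN
      rcases hcN with h | h
      · exact h
      · exact (Nat.even_add.1 h).2 (even_two_mul a)
    obtain ⟨y, rfl⟩ := hxe.two_dvd
    have hy : 4 * (y * (y + a)) = c ^ N := by rw [← hx]; ring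
    have hya : y.Coprime a :=
      (Nat.Coprime.coprime_dvd_right ⟨4 * (y + a), by rw [← hy]; ring⟩ hacN).symm
    have hyy : y.Coprime (y + a) := by rwa [Nat.coprime_self_add_right]
    have h4 {z : ℕ} (hz : Odd z) : z.Coprime 4 :=
      (Nat.Coprime.pow_right 2 (Nat.coprime_two_right.2 hz) : z.Coprime (2 ^ 2))
    rcases Nat.even_or_odd y with hye | hyo
    · have hyo' : Odd (y + a) := hye.add_odd hao
      obtain ⟨d, e, h1, h2, h3⟩ := exists_pow_of_coprime_mul hN
        (Nat.Coprime.mul_right (h4 hyo') hyy.symm)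
        ((by rw [← hy]; ring) : (y + a) * (4 * y) = c ^ N)
      exact ⟨d, e, h3, hce, Or.inr (by rw [← h1, ← h2]; ring)⟩
    · obtain ⟨d, e, h1, h2, h3⟩ := exists_pow_of_coprime_mul hN
        (Nat.Coprime.mul_right (h4 hyo) hyy) ((by rw [← hy]; ring) : y * (4 * (y + a)) = c ^ N)
      exact ⟨d, e, h3, hce, Or.inl (by rw [← h1, ← h2]; ring)⟩
  · left
    have hxo : Odd x := by
      have : Odd (c ^ N) := hco.pow
      rw [← hx, Nat.odd_mul] at this
      exact this.1
    have hxa : x.Coprime a := (Nat.Coprime.coprime_dvd_right ⟨x + 2 * a, hx.symm⟩ hacN).symm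
    have hxy : x.Coprime (x + 2 * a) := by
      rw [Nat.coprime_self_add_right]
      exact Nat.Coprime.mul_right (Nat.coprime_two_right.2 hxo) hxa
    obtain ⟨d, e, h1, h2, h3⟩ := exists_pow_of_coprime_mul hN hxy hx
    exact ⟨d, e, h3, hco, by rw [← h1, ← h2]⟩

/-- The equation `e ^ N = 4 * d ^ N ± 4 * a` has no solutions with `c = d * e < 10 ^ 4`, by
enumeration; the two factors are written `d + 1` and `d + m + 2`. -/
theorem no_small_solution : ∀ k < 6, ∀ d < 100, ∀ m < 203 / (2 ^ (k + 2) - 1),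
    (d + m + 2) ^ (2 ^ (k + 2) - 1) ≠
      4 * (d + 1) ^ (2 ^ (k + 2) - 1) + 4 * orbitNum ((d + 1) * (d + m + 2)) (k + 1) ∧
    (d + m + 2) ^ (2 ^ (k + 2) - 1) + 4 * orbitNum ((d + 1) * (d + m + 2)) (k + 1) ≠
      4 * (d + 1) ^ (2 ^ (k + 2) - 1) := by
  decide +kernel

/-! ### The numerators of the critical orbit are not squares -/

theorem check_of_checkFrom {S l i k : ℕ} (h : checkFrom S l i k = true) {j : ℕ} (hk : k ≤ j)
    (hj : j < k + i) : check S l j = true := by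
  induction i generalizing k with
  | zero => omega
  | succ i ih =>
    rw [checkFrom, force_eq, Bool.and_eq_true] at h
    rcases hk.eq_or_lt with rfl | hk
    · exact h.1
    · exact ih h.2 hk (by omega)

set_option maxHeartbeats 4000000 in
/-- The search succeeds for all exponents `2 ^ k - 1` with `2 ≤ k < 1668`. It is cut into pieces
since the caches of the kernel slow down a long evaluation. -/
theorem checkRange_eq_true : ∀ i < 49, checkRange 34 (34 * i + 2) = true := by
  intro i hi
  interval_cases i <;> decide +kernel

theorem exists_check {k : ℕ} (hk : 2 ≤ k) (hk' : k < 1668) :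
    ∃ S l : ℕ, 0 < S ∧ (l : ℝ) ≤ S * Real.log 2 ∧ S * Real.log 2 ≤ (l : ℝ) + 4000 ∧
      check S l k = true := by
  have h := checkRange_eq_true ((k - 2) / 34) (by omega)
  rw [checkRange, force_eq, force_eq] at h
  obtain ⟨h1, h2⟩ := logTwoSum_sub_one_bounds (le_refl (2 ^ 3500))
  have h3 := check_of_checkFrom h (j := k) (by omega) (by omega)
  have hS : 0 < 2 ^ 3500 := pow_pos two_pos _
  generalize logTwoSum (2 ^ 3500) 3500 0 - 1 = l at *
  generalize 2 ^ 3500 = S at *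
  refine ⟨S, l, hS, h1, h2.trans ?_, h3⟩
  norm_num

/-- The linear form with exponent `N = 2 ^ k - 1` is bounded away from `0` for `0 < N * m ≤ L`. -/
def LinearFormBound (L : ℕ) : Prop :=
  ∀ k m : ℕ, 2 ≤ k → 1 ≤ m → (2 ^ k - 1) * m ≤ L → ∀ (w : ℤ) (ε : ℝ), ε = 1 ∨ ε = -1 →
    ¬ |w - m * formSlope (2 ^ k - 1) + ε * formShift (2 ^ k - 1)| ≤
      24 / (max 40000 ((2 ^ k - 1) * (2 ^ k - 1) * (m * m)) : ℕ)

theorem linearFormBound : LinearFormBound (204 * 10 ^ 498) := by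
  intro k m hk hm hL w ε hε
  have hk' : k < 1668 := by
    by_contra hk'
    have h1 := Nat.pow_le_pow_right two_pos (not_lt.1 hk')
    have h2 := (Nat.le_mul_of_pos_right (2 ^ k - 1) hm).trans hL
    have key (L R : ℕ) (h3 : L < R - 1) (h4 : R ≤ 2 ^ k) (h5 : 2 ^ k - 1 ≤ L) : False := by omega
    exact key _ _ (by decide +kernel) h1 h2
  obtain ⟨S, l, hS, hl, hl', hch⟩ := exists_check hk hk'
  exact not_of_check hS hl hl' (by omega) hch hε hm hL

/-- The error bound of `linear_form` is within the one used in the search when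
`c = r ^ 2 ≥ 10 ^ 4`. -/
theorem error_le {r : ℝ} {N m : ℕ} (hr : 100 ≤ r) (hm : (N : ℝ) * m ≤ 2.036 * r) :
    5.78 / r ^ 2 ≤ 24 / ((max 40000 (N * N * (m * m)) : ℕ) : ℝ) := by
  have h1 : (100 : ℝ) ^ 2 ≤ r ^ 2 := by gcongr
  have h2 : ((max 40000 (N * N * (m * m)) : ℕ) : ℝ) ≤ 4.15 * r ^ 2 := by
    have h3 : ((N : ℝ) * m) ^ 2 ≤ (2.036 * r) ^ 2 := by gcongr
    rw [Nat.cast_max]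
    refine max_le ?_ ?_
    · push_cast
      linarith
    · push_cast
      linarith
  rw [div_le_div_iff₀ (by positivity) (Nat.cast_pos.2 (lt_max_of_lt_left (by norm_num)))]
  linarith

/-- In the range of `c` in question `e ^ N / 4 - d ^ N` is never `± a`. The power `T` of `10` is
kept as a variable so that it is never computed. -/
theorem not_pow_sub_pow {T j d e : ℕ} (hT : LinearFormBound (204 * T)) (hj : 1 ≤ j) (hc : 6 ≤ d * e)
    (hc' : d * e ≤ (100 * T) ^ 2)
    (h : e ^ (2 ^ (j + 1) - 1) = 4 * d ^ (2 ^ (j + 1) - 1) + 4 * orbitNum (d * e) j ∨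
      e ^ (2 ^ (j + 1) - 1) + 4 * orbitNum (d * e) j = 4 * d ^ (2 ^ (j + 1) - 1)) : False := by
  have hd : 0 < d := Nat.pos_of_mul_pos_right (by omega : 0 < d * e)
  have he : 0 < e := Nat.pos_of_mul_pos_left (by omega : 0 < d * e)
  obtain ⟨hu1, hu2⟩ := orbitNum_bounds (by omega : 5 ≤ d * e) j
  have hM : 1 ≤ 2 ^ j - 1 := by
    have := Nat.pow_le_pow_right (n := 2) two_pos hj
    omega
  have hcR : (6 : ℝ) ≤ e * d := by rw [mul_comm]; exact_mod_cast hc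
  have hed : ((d * e : ℕ) : ℝ) = e * d := by push_cast; ring
  have hM1 : 2 ^ j - 1 + 1 = 2 ^ j := Nat.sub_add_cancel Nat.one_le_two_pow
  rw [hed] at hu1 hu2
  have hu : (orbitNum (d * e) j / (e * d) ^ 2 ^ j : ℝ) * (e * d) ^ (2 ^ j - 1 + 1) =
      orbitNum (d * e) j := by
    rw [hM1, div_mul_cancel₀]
    positivity
  obtain ⟨ε, hε, hform⟩ : ∃ ε : ℝ, (ε = 1 ∨ ε = -1) ∧
      (e : ℝ) ^ (2 * (2 ^ j - 1) + 1) / 4 - (d : ℝ) ^ (2 * (2 ^ j - 1) + 1) =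
        ε * ((orbitNum (d * e) j / (e * d) ^ 2 ^ j : ℝ) * (e * d) ^ (2 ^ j - 1 + 1)) := by
    rw [hu, ← two_pow_succ_sub_one]
    rcases h with h | h
    · refine ⟨1, Or.inl rfl, ?_⟩
      have := congrArg (Nat.cast (R := ℝ)) h
      push_cast at this
      linarith
    · refine ⟨-1, Or.inr rfl, ?_⟩
      have := congrArg (Nat.cast (R := ℝ)) h
      push_cast at this
      linarith
  obtain ⟨hlt, hlin, hm⟩ := linear_form hM (Nat.cast_pos.2 he) (Nat.cast_pos.2 hd) hε hcR hu1 hu2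
    hform
  have hlt : d < e := by exact_mod_cast hlt
  obtain ⟨m, rfl⟩ := Nat.exists_eq_add_of_le hlt.le
  have hm0 : 0 < m := by omega
  rw [← two_pow_succ_sub_one] at hlin
  have hNe : (2 * (2 ^ j - 1 : ℕ) + 1 : ℝ) = (2 ^ (j + 1) - 1 : ℕ) := by
    rw [two_pow_succ_sub_one]; push_cast; ring
  rw [hNe, Nat.cast_add, add_sub_cancel_left] at hm
  rcases lt_or_ge (d * (d + m)) (10 ^ 4) with hs | hs
  · -- `√c ≤ 100` leaves `N * m ≤ 203`
    have h1 : √(((d + m : ℕ) : ℝ) * d) ≤ 100 := by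
      rw [Real.sqrt_le_left (by norm_num), mul_comm]
      norm_num at hs ⊢
      exact_mod_cast hs.le
    rw [Nat.cast_add] at h1
    have h2 : (2 ^ (j + 1) - 1) * m ≤ 203 := by
      have : (((2 ^ (j + 1) - 1) * m : ℕ) : ℝ) < 204 := by
        rw [Nat.cast_mul]; linarith
      have : (2 ^ (j + 1) - 1) * m < 204 := by exact_mod_cast this
      omega
    obtain ⟨k, rfl⟩ := Nat.exists_eq_add_of_le' hj
    obtain ⟨n, rfl⟩ := Nat.exists_eq_add_of_le' (show 1 ≤ m from hm0)
    obtain ⟨d, rfl⟩ := Nat.exists_eq_add_of_le' (show 1 ≤ d from hd)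
    have hk : k < 6 := by
      by_contra hk
      have : 2 ^ 8 ≤ 2 ^ (k + 1 + 1) := Nat.pow_le_pow_right two_pos (by omega)
      have := Nat.le_mul_of_pos_right (2 ^ (k + 1 + 1) - 1) (show 0 < n + 1 by omega)
      have := Nat.sub_le_sub_right ‹2 ^ 8 ≤ _› 1
      omega
    have hd' : d < 100 := by nlinarith
    have hn : n < 203 / (2 ^ (k + 2) - 1) := by
      rw [Nat.lt_iff_add_one_le,
        Nat.le_div_iff_mul_le (Nat.sub_pos_of_lt (Nat.one_lt_two_pow (by omega))), mul_comm]
      exact h2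
    obtain ⟨h3, h4⟩ := no_small_solution k hk d hd' n hn
    have e1 : d + 1 + (n + 1) = d + n + 2 := by ring
    rw [e1] at h
    rcases h with h | h
    · exact h3 h
    · exact h4 h
  · -- the additive constant in the bound for `N * m` is at most `0.036 * √c`
    have hr : (100 : ℝ) ≤ √(((d + m : ℕ) : ℝ) * d) := by
      rw [Real.le_sqrt' (by norm_num), mul_comm]
      have : ((10 ^ 4 : ℕ) : ℝ) ≤ ((d * (d + m) : ℕ) : ℝ) := by exact_mod_cast hs
      push_cast at this ⊢
      linarith
    have hr2 : √(((d + m : ℕ) : ℝ) * d) ^ 2 = ((d + m : ℕ) : ℝ) * d := Real.sq_sqrt (by positivity)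
    have hr3 : √(((d + m : ℕ) : ℝ) * d) ≤ (100 * T : ℕ) := by
      rw [Real.sqrt_le_left (Nat.cast_nonneg _), mul_comm, ← Nat.cast_mul, ← Nat.cast_pow]
      exact_mod_cast hc'
    rw [← Nat.cast_add] at hm
    generalize hrd : √(((d + m : ℕ) : ℝ) * d) = r at *
    have hm' : ((2 ^ (j + 1) - 1 : ℕ) : ℝ) * m ≤ 2.036 * r := by linarith
    have hL : (2 ^ (j + 1) - 1) * m ≤ 204 * T := by
      have : (((2 ^ (j + 1) - 1) * m : ℕ) : ℝ) ≤ (204 * T : ℕ) := by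
        push_cast at hr3 hm' ⊢
        linarith
      exact_mod_cast this
    refine hT (j + 1) m (by omega) hm0 hL ((d + m + d : ℕ) : ℤ) ε hε ?_
    have e2 : ((((d + m + d : ℕ) : ℤ) : ℝ)) = ((d + m : ℕ) : ℝ) + d := by push_cast; ring
    have e3 : (((d + m : ℕ) : ℝ)) - d = m := by push_cast; ring
    rw [e3] at hlin
    rw [e2]
    refine hlin.trans ?_
    rw [← hr2]
    exact error_le hr hm'

/-- The numerators of the critical orbit are not squares; applied with `T = 10 ^ 498`. -/
theorem not_isSquare_orbitNum {T c k : ℕ} (hT : LinearFormBound (204 * T)) (hc : 1 ≤ c)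
    (hc' : c ≤ (100 * T) ^ 2) (hk : 2 ≤ k) : ¬ IsSquare (orbitNum c k) := by
  rcases lt_or_ge c 5 with h5 | h5
  · exact not_isSquare_orbitNum_of_lt_five hc h5 hk
  obtain ⟨j, rfl⟩ := Nat.exists_eq_add_of_le' (show 1 ≤ k by omega)
  have hj : 1 ≤ j := by omega
  rintro ⟨b, hb⟩
  rw [orbitNum, ← sq] at hb
  have hN : 2 ^ (j + 1) - 1 ≠ 0 := by rw [two_pow_succ_sub_one]; exact Nat.succ_ne_zero _
  rcases factorizations_of_sq_add_pow_eq_sq hN (coprime_orbitNum c j) hb with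
    ⟨d, e, rfl, hodd, h⟩ | ⟨d, e, rfl, heven, h⟩
  · have hd : 0 < d := Nat.pos_of_mul_pos_right (by omega : 0 < d * e)
    have he : 0 < e := Nat.pos_of_mul_pos_left (by omega : 0 < d * e)
    obtain ⟨hu1, hu2⟩ := orbitNum_bounds h5 j
    have hM : 1 ≤ 2 ^ j - 1 := by
      have := Nat.pow_le_pow_right (n := 2) two_pos hj
      omega
    have hM1 : 2 ^ j - 1 + 1 = 2 ^ j := Nat.sub_add_cancel Nat.one_le_two_pow
    have hed : ((d * e : ℕ) : ℝ) = e * d := by push_cast; ring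
    rw [hed] at hu1 hu2
    have hcR : (5 : ℝ) ≤ e * d := by rw [mul_comm]; exact_mod_cast h5
    have h1 := sub_lt_two_of_pow_sub_pow hM (Nat.cast_pos.2 he) (Nat.cast_pos.2 hd) hcR hu1 hu2 (by
      rw [hM1, div_mul_cancel₀ _ (by positivity), ← two_pow_succ_sub_one]
      have := congrArg (Nat.cast (R := ℝ)) h
      push_cast at this
      linarith)
    have h2 : e < d + 2 := by
      have : (e : ℝ) < d + 2 := by linarith
      exact_mod_cast this
    have h3 : d < e := by
      have h4 : 0 < orbitNum (d * e) j := Nat.pos_of_ne_zero fun h0 => by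
        have := coprime_orbitNum (d * e) j
        rw [h0, Nat.coprime_zero_left] at this
        omega
      by_contra hle
      have := Nat.pow_le_pow_left (not_lt.1 hle) (2 ^ (j + 1) - 1)
      omega
    obtain rfl : e = d + 1 := by omega
    rw [Nat.odd_mul] at hodd
    exact Nat.not_even_iff_odd.2 hodd.2 hodd.1.add_one
  · obtain ⟨n, hn⟩ := heven
    exact not_pow_sub_pow hT hj (by omega) hc' h

/-! ### Irreducibility of the iterates -/

theorem exists_comp_of_comp_neg_X {F : Type*} [Field F] [CharZero F] {p : F[X]}
    (hp : p.comp (-X) = p) (r : F) : ∃ q : F[X], p = q.comp (X ^ 2 + C r) := by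
  have h : p = (contract 2 p).comp (X ^ 2) := by
    rw [← expand_eq_comp_X_pow]
    ext n
    rw [coeff_expand two_pos]
    split_ifs with hn
    · rw [coeff_contract two_ne_zero, Nat.div_mul_cancel hn]
    · have h1 := congrArg (fun q => coeff q n) hp
      have hodd : Odd n := Nat.not_even_iff_odd.1 fun h => hn h.two_dvd
      have e : (-X : F[X]) = C (-1) * X := by simp
      simp only [e, comp_C_mul_X_coeff, hodd.neg_one_pow, mul_neg_one] at h1
      exact self_eq_neg.1 h1.symm
  refine ⟨(contract 2 p).comp (X - C r), ?_⟩
  rw [comp_assoc]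
  simpa using h

/-- The one-step irreducibility criterion. An irreducible factor `p` of `g (x ^ 2 + r)` either is
even, hence comes from a factor of `g`, or `p (x) * p (-x)` does; in the second case the constant
coefficient is `p (0) ^ 2`. -/
theorem irreducible_comp_sq_add {g : ℚ[X]} (hg : Irreducible g) (hm : g.Monic)
    (he : Even g.natDegree) (r : ℚ) (h0 : ¬ IsSquare ((g.comp (X ^ 2 + C r)).eval 0)) :
    Irreducible (g.comp (X ^ 2 + C r)) := by
  set f : ℚ[X] := X ^ 2 + C r with hf
  have hfdeg : f.natDegree = 2 := natDegree_X_pow_add_C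
  have hfm : f.Monic := monic_X_pow_add_C r two_ne_zero
  have hfneg : f.comp (-X) = f := by simp [hf]
  set h := g.comp f with hh
  have hhm : h.Monic := hm.comp hfm (by omega)
  have hhdeg : h.natDegree = g.natDegree * 2 := by rw [hh, natDegree_comp, hfdeg]
  have hhu : ¬ IsUnit h := by
    intro hu
    have h1 := natDegree_eq_zero_of_isUnit hu
    have h2 := hg.natDegree_pos
    omega
  have hhneg : h.comp (-X) = h := by rw [hh, comp_assoc, hfneg]
  -- an even polynomial with a common factor with `h` is divisible by `h`
  have key : ∀ p q : ℚ[X], Irreducible p → p ∣ h → p ∣ q → q.comp (-X) = q → h ∣ q := by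
    intro p q hp hph hpq hq
    obtain ⟨s, rfl⟩ := exists_comp_of_comp_neg_X hq r
    by_contra hdvd
    have hcop : IsCoprime g s := by
      rw [hg.coprime_iff_not_dvd]
      rintro ⟨t, rfl⟩
      exact hdvd ⟨t.comp f, mul_comp _ _ _⟩
    obtain ⟨a, b, hab⟩ := hcop
    have h1 := congrArg (fun t => t.comp f) hab
    simp only [add_comp, mul_comp, one_comp] at h1
    exact hp.not_isUnit (isUnit_of_dvd_one (h1 ▸ dvd_add (hph.mul_left _) (hpq.mul_left _)))
  obtain ⟨p, hpm, hp, hph⟩ := exists_monic_irreducible_factor h hhu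
  have hp' : Irreducible (p.comp (-X)) :=
    (MulEquiv.irreducible_iff (algEquivAevalNegX (R := ℚ))).2 hp
  have hp'h : p.comp (-X) ∣ h := by
    obtain ⟨t, ht⟩ := hph
    exact ⟨t.comp (-X), by rw [← mul_comp, ← ht, hhneg]⟩
  have hpp : (p.comp (-X)).comp (-X) = p := by rw [comp_assoc]; simp
  have hdeg' : (p.comp (-X)).natDegree = p.natDegree := by simp [natDegree_comp]
  by_cases hass : p ∣ p.comp (-X)
  · -- `p (-x) = p (x)`, as otherwise `p (-x) = - p (x)` and `h (0) = 0`
    obtain ⟨t, ht⟩ := hass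
    have ht0 : t.natDegree = 0 := by
      have h1 := congrArg natDegree ht
      have ht1 : t ≠ 0 := by
        rintro rfl
        rw [mul_zero] at ht
        exact hp'.ne_zero ht
      rw [natDegree_mul hp.ne_zero ht1, hdeg'] at h1
      omega
    rw [eq_C_of_natDegree_eq_zero ht0] at ht
    have hev := congrArg (eval 0) ht
    simp only [eval_comp, eval_neg, eval_X, neg_zero, eval_mul, eval_C] at hev
    have hp0 : p.eval 0 ≠ 0 := by
      intro hp0
      obtain ⟨s, hs⟩ := hph
      apply h0
      rw [hs, eval_mul, hp0, zero_mul]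
      exact IsSquare.zero
    have ht2 : t.coeff 0 = 1 := mul_left_cancel₀ hp0 (by rw [← hev, mul_one])
    rw [ht2, C_1, mul_one] at ht
    have := associated_of_dvd_dvd (key p p hp hph dvd_rfl ht) hph
    exact this.symm.irreducible hp
  · exfalso
    have hcop : IsCoprime p (p.comp (-X)) := by rwa [hp.coprime_iff_not_dvd]
    have h1 : p * p.comp (-X) ∣ h := hcop.mul_dvd hph hp'h
    have h2 : h ∣ p * p.comp (-X) :=
      key p _ hp hph (dvd_mul_right _ _) (by rw [mul_comp, hpp, mul_comm])
    have hdeg : p.natDegree = g.natDegree := by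
      have h3 := le_antisymm (natDegree_le_of_dvd h1 hhm.ne_zero)
        (natDegree_le_of_dvd h2 (mul_ne_zero hp.ne_zero hp'.ne_zero))
      rw [natDegree_mul hp.ne_zero hp'.ne_zero, hdeg', hhdeg] at h3
      omega
    have hmon : (p * p.comp (-X)).Monic := by
      refine hpm.mul ?_
      rw [Monic, leadingCoeff_comp (by simp), hpm.leadingCoeff, leadingCoeff_neg, leadingCoeff_X,
        hdeg, he.neg_one_pow, one_mul]
    have h4 := eq_of_monic_of_associated hmon hhm (associated_of_dvd_dvd h1 h2)
    apply h0
    rw [← h4, eval_mul, eval_comp]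
    simp

theorem iterate_comp_succ (f : ℚ[X]) (n : ℕ) : f.comp^[n + 1] X = (f.comp^[n] X).comp f := by
  induction n with
  | zero => simp
  | succ n ih =>
    rw [Function.iterate_succ_apply', ih, ← comp_assoc, ← ih, Function.iterate_succ_apply' f.comp n]

theorem eval_zero_iterate {c : ℕ} (hc : 0 < c) (k : ℕ) :
    ((X ^ 2 + C (1 / (c : ℚ)) : ℚ[X]).comp^[k + 1] X).eval 0 = orbitNum c k / (c : ℚ) ^ 2 ^ k := by
  have hc' : (c : ℚ) ≠ 0 := by positivity
  induction k with
  | zero => simp [orbitNum]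
  | succ k ih =>
    have h : (c : ℚ) ^ 2 ^ (k + 1) = c ^ (2 ^ (k + 1) - 1) * c := by
      rw [← pow_succ, Nat.sub_add_cancel Nat.one_le_two_pow]
    rw [Function.iterate_succ_apply', eval_comp, ih]
    simp only [eval_add, eval_pow, eval_X, eval_C]
    rw [orbitNum, Nat.cast_add, add_div, Nat.cast_pow, Nat.cast_pow]
    congr 1
    · rw [div_pow, ← pow_mul, ← pow_succ]
    · rw [h, div_mul_cancel_left₀ (by positivity), one_div]

theorem monic_iterate {f : ℚ[X]} (hf : f.Monic) (hd : f.natDegree = 2) (n : ℕ) :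
    (f.comp^[n] X).Monic ∧ (f.comp^[n] X).natDegree = 2 ^ n := by
  induction n with
  | zero => exact ⟨monic_X, natDegree_X⟩
  | succ n ih =>
    rw [iterate_comp_succ]
    exact ⟨ih.1.comp hf (by omega), by rw [natDegree_comp, ih.2, hd, pow_succ]⟩

theorem mainTheorem8 (c : ℤ) (hc_pos : 0 < c) (hc_le : c ≤ 10 ^ 1000)
    (f : ℚ[X]) (hf : f = X ^ 2 + C (1 / (c : ℚ)))
    (hf2 : Irreducible (f.comp^[2] X)) :
    ∀ n : ℕ, Irreducible (f.comp^[n] X) := by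
  lift c to ℕ using hc_pos.le
  rw [Int.cast_natCast] at hf
  have hc : 0 < c := by exact_mod_cast hc_pos
  have hc_sq : c ≤ (100 * 10 ^ 498) ^ 2 := by
    have h : (10 : ℕ) ^ 1000 = (100 * 10 ^ 498) ^ 2 := by decide +kernel
    rw [← h]
    exact Int.ofNat_le.1 (hc_le.trans_eq (Nat.cast_pow 10 1000).symm)
  have hfm : f.Monic := hf ▸ monic_X_pow_add_C _ two_ne_zero
  have hfd : f.natDegree = 2 := hf ▸ natDegree_X_pow_add_C
  have step (n : ℕ) : Irreducible (f.comp^[n + 2] X) := by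
    induction n with
    | zero => exact hf2
    | succ n ih =>
      obtain ⟨hm, hd⟩ := monic_iterate hfm hfd (n + 2)
      have h0 : ¬ IsSquare ((f.comp^[n + 2 + 1] X).eval 0) := by
        rw [hf, eval_zero_iterate hc]
        rintro ⟨x, hx⟩
        refine not_isSquare_orbitNum linearFormBound hc hc_sq (by omega : 2 ≤ n + 2)
          (Rat.isSquare_natCast_iff.1 ⟨x * c ^ 2 ^ (n + 1), ?_⟩)
        rw [pow_succ 2 (n + 1), pow_mul, div_eq_iff (by positivity)] at hx
        rw [hx]; ring
      rw [show n + 1 + 2 = n + 2 + 1 by ring, iterate_comp_succ]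
      rw [iterate_comp_succ] at h0
      nth_rewrite 2 [hf] at h0 ⊢
      refine irreducible_comp_sq_add ih hm ?_ _ h0
      rw [hd]
      exact even_two.pow_of_ne_zero (by omega)
  intro n
  match n with
  | 0 => exact irreducible_X
  | 1 =>
    change Irreducible (f.comp X)
    rw [comp_X]
    rw [hfm.irreducible_iff_roots_eq_zero_of_degree_le_three hfd.ge (hfd.le.trans (by norm_num)),
      Multiset.eq_zero_iff_forall_notMem]
    intro x hx
    have h1 := (mem_roots'.1 hx).2
    rw [hf, IsRoot, eval_add, eval_pow, eval_X, eval_C] at h1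
    have : (0 : ℚ) < 1 / c := by positivity
    linarith [sq_nonneg x]
  | n + 2 => exact step n
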